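/- Let $\xi$ be a real random variable with $\mathbb{E}\,\xi=0$, $\mathbb{E}\,\xi^2=1$ and $\mathbb{E}\,\xi^4<\infty$, and let $(\xi_{i,j})_{i,j=1}^{\infty}$ be independent copies of $\xi$. For every $d\in\mathbb{N}$ consider the random walk in $\mathbb{R}^d$ given by $$ X_i^{(d)}:=\frac{(\xi_{i,1},\dots,\xi_{i,d})}{\sqrt d},\qquad S_0^{(d)}:=0,\qquad S_k^{(d)}:=X_1^{(d)}+\dots+X_k^{(d)},\quad k\in\mathbb{N}, $$ and let $\|\cdot\|$ denote the Euclidean norm. Then, for every sequence $n=n(d)$ of positive integers such that $n(d)\to\infty$ as $d\to\infty$, $$ \frac{\|S_{n}^{(d)}\|^2-n}{\sqrt{2n^2/d}}\;\longrightarrow\;\mathrm{N}(0,1)\qquad\text{in distribution, as } d\to\infty, $$ where $\mathrm{N}(0,1)$ is the standard normal distribution. -/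

import Mathlib

open MeasureTheory ProbabilityTheory Filter

noncomputable section

/-- The `i`-th increment of the `d`-dimensional walk, `X_i^{(d)} = (ξ_{i,1}, …, ξ_{i,d}) / √d`, as a
random vector in Euclidean space. Rows and columns of the array `ξ` are numbered from `0`. -/
def walkIncrement {Ω : Type*} (ξ : ℕ → ℕ → Ω → ℝ) (d i : ℕ) (ω : Ω) : EuclideanSpace ℝ (Fin d) :=
  (√(d : ℝ))⁻¹ • WithLp.toLp 2 (fun j : Fin d => ξ i j ω)

/-- The `d`-dimensional random walk after `k` steps: the sum of its first `k` increments. -/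
def walkPosition {Ω : Type*} (ξ : ℕ → ℕ → Ω → ℝ) (d k : ℕ) (ω : Ω) : EuclideanSpace ℝ (Fin d) :=
  ∑ i ∈ Finset.range k, walkIncrement ξ d i ω

end

/-! The squared norm splits over coordinates, so the normalized quantity equals `d^(-1/2) ∑_{j<d}
W_j`, where `W_j = ((∑_{i<n} ξ_ij)² / n - 1) / √2`. For fixed `d` the `W_j` are i.i.d., but their
law changes with `n = n(d)`, so a central limit theorem for triangular arrays is needed. For `n >
0`, `W_j` has mean 0 and variance `1 + (μ₄ - 3) / (2n)`, which tends to 1. The Lindeberg-type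
condition is uniform integrability of `W_j²`, obtained without moments beyond the fourth. By the
classical CLT, `W_j²` converges in law to `(Z² - 1)² / 2` with `Z` standard normal, and its mean
converges to the mean 1 of that limit; for nonnegative variables this forces uniform integrability
(`exists_eventually_integral_sub_min_le`). Then `tendsto_charFun_pow_of_uniform_truncation` gives
convergence of characteristic functions. No relation between the growth of `n` and `d` enters. -/

open scoped Topology

/-! ### Taylor estimates for `exp (i x)` -/

/-- Second order Taylor bound for the complex exponential on the imaginary axis. -/
lemma norm_exp_ofReal_mul_I_sub_taylor_le_sq (x : ℝ) :
    ‖Complex.exp (x * Complex.I) - (1 + x * Complex.I - (x : ℂ) ^ 2 / 2)‖ ≤ 4 * x ^ 2 ∧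
    ‖Complex.exp (x * Complex.I) - (1 + x * Complex.I - (x : ℂ) ^ 2 / 2)‖ ≤ 4 * |x| ^ 3 := by
  rcases le_total |x| 1 with h | h
  · have h1 := Complex.exp_bound (x := x * Complex.I) (by simpa using h) (n := 3) (by norm_num)
    have h2 : ∑ m ∈ Finset.range 3, (x * Complex.I) ^ m / (m.factorial : ℂ)
        = 1 + x * Complex.I - (x : ℂ) ^ 2 / 2 := by
      simp [Finset.sum_range_succ, mul_pow, Nat.factorial]
      ring
    rw [h2] at h1
    have h3 : ‖(x : ℂ) * Complex.I‖ = |x| := by simp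
    rw [h3] at h1
    norm_num [Nat.factorial] at h1
    have h4 : 0 ≤ |x| ^ 3 := by positivity
    have h5 : |x| ^ 3 ≤ x ^ 2 := by
      rw [← sq_abs]; nlinarith [sq_nonneg |x|]
    exact ⟨by linarith, by linarith⟩
  · have h1 : ‖Complex.exp (x * Complex.I) - (1 + x * Complex.I - (x : ℂ) ^ 2 / 2)‖
        ≤ 1 + (1 + |x| + x ^ 2 / 2) := by
      refine (norm_sub_le _ _).trans (add_le_add (Complex.norm_exp_ofReal_mul_I x).le ?_)
      refine (norm_sub_le _ _).trans (add_le_add ((norm_add_le _ _).trans ?_) ?_)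
      · simp
      · simp
    have h2 : |x| ≤ x ^ 2 := by rw [← sq_abs]; nlinarith
    have h3 : x ^ 2 ≤ |x| ^ 3 := by rw [← sq_abs]; nlinarith [sq_nonneg |x|]
    exact ⟨by linarith, by linarith⟩

/-- Split at `x² = 2K`. Below, the cubic bound applies with `|x| ≤ 1 + 2K`. Above, `x²` is at most
twice its excess over `K`, so the quadratic bound is absorbed by the truncation error; cutting at
`2K` rather than `K` makes this possible. -/
lemma norm_exp_mul_I_sub_taylor_le_truncation (s x : ℝ) {K : ℝ} (hK : 0 ≤ K) :
    ‖Complex.exp ((s * x : ℝ) * Complex.I)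
      - (1 + (s * x : ℝ) * Complex.I - ((s * x : ℝ) : ℂ) ^ 2 / 2)‖
    ≤ 8 * s ^ 2 * (x ^ 2 - min (x ^ 2) K) + 4 * |s| ^ 3 * (1 + 2 * K) * x ^ 2 := by
  obtain ⟨h1, h2⟩ := norm_exp_ofReal_mul_I_sub_taylor_le_sq (s * x)
  have hs : 0 ≤ |s| ^ 3 := by positivity
  rcases le_total (x ^ 2) (2 * K) with h | h
  · have h3 : |x| ≤ 1 + 2 * K := by
      rw [← sq_abs] at h; nlinarith [sq_nonneg (|x| - 1)]
    have h4 : |s * x| ^ 3 ≤ |s| ^ 3 * (1 + 2 * K) * x ^ 2 := by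
      rw [abs_mul, mul_pow, mul_assoc, ← sq_abs x, pow_succ |x|, mul_comm (1 + 2 * K)]
      gcongr
    have h5 : 0 ≤ 8 * s ^ 2 * (x ^ 2 - min (x ^ 2) K) :=
      mul_nonneg (by positivity) (sub_nonneg.2 (min_le_left _ _))
    linarith
  · have h3 : x ^ 2 / 2 ≤ x ^ 2 - min (x ^ 2) K := by
      have := min_le_right (x ^ 2) K
      linarith
    have h4 : 0 ≤ 4 * |s| ^ 3 * (1 + 2 * K) * x ^ 2 := by positivity
    have h5 : 8 * s ^ 2 * (x ^ 2 / 2) ≤ 8 * s ^ 2 * (x ^ 2 - min (x ^ 2) K) := by gcongr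
    nlinarith [mul_pow s x 2]

/-! ### Uniform integrability and the triangular-array limit -/

section

variable {Ω Ω' : Type*} {mΩ : MeasurableSpace Ω} {mΩ' : MeasurableSpace Ω'}
  {P : Measure Ω} [IsProbabilityMeasure P] {P' : Measure Ω'} [IsProbabilityMeasure P']

/-- If nonnegative variables converge in distribution together with their means, then their
truncation errors are eventually uniformly small. -/
lemma exists_eventually_integral_sub_min_le {X : ℕ → Ω → ℝ} {Z : Ω' → ℝ}
    (h : TendstoInDistribution X atTop Z (fun _ => P) P')
    (hX0 : ∀ m ω, 0 ≤ X m ω) (hZ0 : ∀ ω, 0 ≤ Z ω)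
    (hX : ∀ m, Integrable (X m) P) (hZ : Integrable Z P')
    (hlim : Tendsto (fun m => ∫ ω, X m ω ∂P) atTop (𝓝 (∫ ω, Z ω ∂P')))
    {ε : ℝ} (hε : 0 < ε) :
    ∃ K : ℝ, 0 ≤ K ∧ ∀ᶠ m in atTop, ∫ ω, (X m ω - min (X m ω) K) ∂P ≤ ε := by
  have hmin (m : ℕ) (K : ℝ) : Integrable (fun ω => min (X m ω) K) P :=
    (hX m).inf (integrable_const K)
  have hminZ (K : ℝ) : Integrable (fun ω => min (Z ω) K) P' := hZ.inf (integrable_const K)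
  have hK : Tendsto (fun k : ℕ => ∫ ω, min (Z ω) k ∂P') atTop (𝓝 (∫ ω, Z ω ∂P')) := by
    refine tendsto_integral_of_dominated_convergence Z
      (fun k => (hminZ k).aestronglyMeasurable) hZ (fun k => ae_of_all _ fun ω => ?_)
      (ae_of_all _ fun ω => ?_)
    · rw [Real.norm_of_nonneg (le_min (hZ0 ω) k.cast_nonneg)]
      exact min_le_left _ _
    · refine tendsto_const_nhds.congr' ?_
      filter_upwards [eventually_ge_atTop ⌈Z ω⌉₊] with k hk
      exact (min_eq_left (Nat.ceil_le.1 hk)).symm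
  obtain ⟨k, hk⟩ := (hK.eventually_const_lt (show _ - ε < _ from sub_lt_self _ hε)).exists
  refine ⟨k, k.cast_nonneg, ?_⟩
  -- Clamping below by 0 makes the test function bounded without changing it on nonnegative values.
  have hcont : Continuous fun x : ℝ => max 0 (min x (k : ℝ)) := by fun_prop
  let f : BoundedContinuousFunction ℝ ℝ := BoundedContinuousFunction.ofNormedAddCommGroup
    (fun x : ℝ => max 0 (min x (k : ℝ))) hcont k (fun x => by
      rw [Real.norm_of_nonneg (le_max_left _ _)]
      exact max_le k.cast_nonneg (min_le_right _ _))
  have hf := ProbabilityMeasure.tendsto_iff_forall_integral_tendsto.1 h.tendsto f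
  have e1 (m : ℕ) : ∫ x, f x ∂(P.map (X m)) = ∫ ω, min (X m ω) k ∂P := by
    rw [integral_map (h.forall_aemeasurable m) f.continuous.aestronglyMeasurable]
    exact integral_congr_ae (ae_of_all _ fun ω => max_eq_right (le_min (hX0 m ω) k.cast_nonneg))
  have e2 : ∫ x, f x ∂(P'.map Z) = ∫ ω, min (Z ω) k ∂P' := by
    rw [integral_map h.aemeasurable_limit f.continuous.aestronglyMeasurable]
    exact integral_congr_ae (ae_of_all _ fun ω => max_eq_right (le_min (hZ0 ω) k.cast_nonneg))
  simp only [ProbabilityMeasure.coe_mk, e1, e2] at hf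
  have := (hlim.sub hf).eventually_lt_const (u := ε) (by linarith)
  filter_upwards [this] with m hm
  rw [integral_sub (hX m) (hmin m _)]
  exact hm.le

/-- Central limit theorem for the characteristic functions of a row-wise identically distributed
triangular array, under uniform integrability of the squares. -/
lemma tendsto_charFun_pow_of_uniform_truncation {W : ℕ → Ω → ℝ} (hW : ∀ d, MemLp (W d) 2 P)
    (hmean : ∀ᶠ d in atTop, ∫ ω, W d ω ∂P = 0)
    (hvar : Tendsto (fun d => ∫ ω, W d ω ^ 2 ∂P) atTop (𝓝 1))
    (hui : ∀ ε > 0, ∃ K : ℝ, 0 ≤ K ∧ ∀ᶠ d in atTop,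
      ∫ ω, (W d ω ^ 2 - min (W d ω ^ 2) K) ∂P ≤ ε) (t : ℝ) :
    Tendsto (fun d : ℕ => charFun (P.map (W d)) ((√(d : ℝ))⁻¹ * t) ^ d) atTop
      (𝓝 (Complex.exp (-(t : ℂ) ^ 2 / 2))) := by
  have hsq (d : ℕ) : Integrable (fun ω => W d ω ^ 2) P := (hW d).integrable_sq
  have h1 (d : ℕ) : Integrable (W d) P := (hW d).integrable (by norm_num)
  have hmeas (d : ℕ) : AEMeasurable (W d) P := (h1 d).aemeasurable
  have hbound (d : ℕ) (s K : ℝ) (hK : 0 ≤ K) (hm : ∫ ω, W d ω ∂P = 0) :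
      ‖charFun (P.map (W d)) s - (1 - (s : ℂ) ^ 2 / 2 * (∫ ω, W d ω ^ 2 ∂P : ℝ))‖ ≤
        8 * s ^ 2 * ∫ ω, (W d ω ^ 2 - min (W d ω ^ 2) K) ∂P
        + 4 * |s| ^ 3 * (1 + 2 * K) * ∫ ω, W d ω ^ 2 ∂P := by
    have hmin : Integrable (fun ω => W d ω ^ 2 - min (W d ω ^ 2) K) P :=
      (hsq d).sub ((hsq d).inf (integrable_const K))
    have iexp : Integrable (fun ω => Complex.exp ((s * W d ω : ℝ) * Complex.I)) P := by
      refine Integrable.of_bound (C := 1) ?_ (ae_of_all _ fun ω => ?_)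
      · have := hmeas d
        exact AEMeasurable.aestronglyMeasurable (by fun_prop)
      · exact (Complex.norm_exp_ofReal_mul_I _).le
    have i1 : Integrable (fun ω => ((s * W d ω : ℝ) : ℂ) * Complex.I) P :=
      (((h1 d).const_mul s).ofReal).mul_const _
    have i2 : Integrable (fun ω => ((s * W d ω : ℝ) : ℂ) ^ 2 / 2) P := by
      have := (((hsq d).const_mul (s ^ 2)).ofReal (𝕜 := ℂ)).div_const 2
      refine this.congr (ae_of_all _ fun ω => ?_)
      push_cast
      simp [mul_pow]
    have e : charFun (P.map (W d)) s - (1 - (s : ℂ) ^ 2 / 2 * (∫ ω, W d ω ^ 2 ∂P : ℝ)) =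
        ∫ ω, (Complex.exp ((s * W d ω : ℝ) * Complex.I)
          - (1 + (s * W d ω : ℝ) * Complex.I - ((s * W d ω : ℝ) : ℂ) ^ 2 / 2)) ∂P := by
      have i0 : Integrable (fun _ : Ω => (1 : ℂ)) P := integrable_const _
      have i01 : Integrable (fun ω => 1 + ((s * W d ω : ℝ) : ℂ) * Complex.I) P := i0.add i1
      have i012 : Integrable (fun ω => 1 + ((s * W d ω : ℝ) : ℂ) * Complex.I
          - ((s * W d ω : ℝ) : ℂ) ^ 2 / 2) P := i01.sub i2
      rw [integral_sub iexp i012, integral_sub i01 i2, integral_add i0 i1,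
        charFun_apply_real, integral_map (hmeas d) (by fun_prop)]
      have a1 : ∫ ω, ((s * W d ω : ℝ) : ℂ) * Complex.I ∂P = 0 := by
        rw [integral_mul_const, integral_complex_ofReal, integral_const_mul, hm]; simp
      have a2 : ∫ ω, ((s * W d ω : ℝ) : ℂ) ^ 2 / 2 ∂P
          = (s : ℂ) ^ 2 / 2 * (∫ ω, W d ω ^ 2 ∂P : ℝ) := by
        rw [← integral_complex_ofReal, ← integral_const_mul]
        congr 1 with ω
        push_cast; ring
      rw [a1, a2]
      simp
    rw [e]
    refine (norm_integral_le_of_norm_le ?_ (ae_of_all _ fun ω =>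
      norm_exp_mul_I_sub_taylor_le_truncation s (W d ω) hK)).trans_eq ?_
    · exact (hmin.const_mul _).add ((hsq d).const_mul _)
    · rw [integral_add (hmin.const_mul _) ((hsq d).const_mul _), integral_const_mul,
        integral_const_mul]
  have hs0 : Tendsto (fun d : ℕ => (√(d : ℝ))⁻¹) atTop (𝓝 0) :=
    tendsto_inv_atTop_zero.comp (Real.tendsto_sqrt_atTop.comp tendsto_natCast_atTop_atTop)
  -- It remains to show that the characteristic function at `t / √d` is `1 - t² / (2d) + o(1/d)`.
  apply Complex.tendsto_pow_exp_of_isLittleO_sub_add_div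
  rw [Asymptotics.isLittleO_iff]
  intro c hc
  -- Chosen so that `8 t²` times the truncation error is at most `c / 4`; the `+ 1` covers `t = 0`.
  obtain ⟨K, hK0, hK⟩ := hui (c / (4 * (8 * t ^ 2 + 1))) (by positivity)
  have hlim1 : Tendsto (fun d : ℕ => 4 * |t| ^ 3 * (√(d : ℝ))⁻¹ * (1 + 2 * K) *
      ∫ ω, W d ω ^ 2 ∂P) atTop (𝓝 0) := by
    simpa using (((hs0.const_mul (4 * |t| ^ 3)).mul_const (1 + 2 * K)).mul hvar)
  have hlim2 : Tendsto (fun d : ℕ => t ^ 2 / 2 * |∫ ω, W d ω ^ 2 ∂P - 1|) atTop (𝓝 0) := by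
    simpa using ((hvar.sub_const 1).abs.const_mul (t ^ 2 / 2))
  filter_upwards [hmean, hK, hlim1.eventually_le_const (show 0 < c / 4 by positivity),
    hlim2.eventually_le_const (show 0 < c / 4 by positivity), eventually_gt_atTop 0]
    with d hm hd1 hd2 hd3 hd0
  have hdpos : (0 : ℝ) < d := by exact_mod_cast hd0
  set r := (√(d : ℝ))⁻¹ with hr
  have hr0 : 0 < r := by positivity
  have hr2 : r ^ 2 = 1 / d := by rw [hr, inv_pow, Real.sq_sqrt hdpos.le, one_div]
  set V := ∫ ω, W d ω ^ 2 ∂P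
  set U := ∫ ω, (W d ω ^ 2 - min (W d ω ^ 2) K) ∂P
  have hb := hbound d (r * t) K hK0 hm
  -- Taylor remainder plus the effect of the variance `V` differing from 1.
  have hdecomp : charFun (P.map (W d)) (r * t) - (1 + -(t : ℂ) ^ 2 / 2 / d) =
      (charFun (P.map (W d)) (r * t) - (1 - ((r * t : ℝ) : ℂ) ^ 2 / 2 * (V : ℝ)))
      + ((-(r ^ 2 * (t ^ 2 / 2) * (V - 1)) : ℝ) : ℂ) := by
    have : ((r ^ 2 : ℝ) : ℂ) = 1 / d := by rw [hr2]; push_cast; rfl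
    push_cast at this ⊢
    rw [mul_pow, this]
    ring
  rw [hdecomp]
  have hnd : ‖(1 / (d : ℂ))‖ = r ^ 2 := by rw [hr2]; simp
  rw [hnd]
  refine (norm_add_le _ _).trans ((add_le_add_left hb _).trans ?_)
  rw [Complex.norm_real, norm_neg, Real.norm_eq_abs, abs_mul, abs_mul, abs_mul, mul_pow, mul_pow,
    abs_of_nonneg (sq_nonneg r), abs_of_pos hr0, abs_of_nonneg (show 0 ≤ t ^ 2 / 2 by positivity)]
  have hU : 8 * t ^ 2 * U ≤ c / 4 := by
    calc 8 * t ^ 2 * U ≤ 8 * t ^ 2 * (c / (4 * (8 * t ^ 2 + 1))) := by gcongr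
      _ = c / 4 * (8 * t ^ 2 / (8 * t ^ 2 + 1)) := by field_simp
      _ ≤ c / 4 * 1 := by
        gcongr
        rw [div_le_one (by positivity)]
        linarith
      _ = c / 4 := mul_one _
  calc _ = r ^ 2 * (8 * t ^ 2 * U + 4 * |t| ^ 3 * r * (1 + 2 * K) * V
        + t ^ 2 / 2 * |V - 1|) := by ring
    _ ≤ r ^ 2 * (c / 4 + c / 4 + c / 4) := by gcongr
    _ ≤ c * r ^ 2 := by nlinarith [sq_nonneg r]

end

/-! ### Moments of the standard normal law -/

lemma integral_pow_four_gaussianReal : ∫ x, x ^ 4 ∂(gaussianReal 0 1) = 3 := by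
  have h := iteratedDeriv_mgf_zero (X := id) (μ := gaussianReal 0 1) (by simp) 4
  have hd (p q : ℝ → ℝ) (hp : ∀ t, HasDerivAt p (q t) t) :
      deriv (fun t => p t * Real.exp (t ^ 2 / 2))
        = fun t => (q t + t * p t) * Real.exp (t ^ 2 / 2) := by
    ext t
    have h1 : HasDerivAt (fun t : ℝ => Real.exp (t ^ 2 / 2)) (Real.exp (t ^ 2 / 2) * t) t := by
      convert ((hasDerivAt_pow 2 t).div_const 2).exp using 1
      simp
    have h2 : HasDerivAt (fun t => p t * Real.exp (t ^ 2 / 2)) _ t := (hp t).mul h1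
    rw [h2.deriv]
    ring
  have e0 : mgf id (gaussianReal 0 1) = fun t => (1 : ℝ) * Real.exp (t ^ 2 / 2) := by
    rw [mgf_id_gaussianReal]; simp
  -- Each derivative of the moment generating function is a polynomial times `exp (t² / 2)`, with
  -- `p` replaced by `p' + t p`. The polynomials stay unsimplified so that the rewrites chain
  -- syntactically.
  have e1 := hd (fun _ => 1) (fun _ => 0) (fun t => hasDerivAt_const _ _)
  have e2 := hd (fun t => 0 + t * 1) (fun _ => 1) (fun t => by simpa using hasDerivAt_id' t)
  have e3 := hd (fun t => 1 + t * (0 + t * 1)) (fun t => 2 * t) (fun t => by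
    simpa [pow_two] using (hasDerivAt_pow 2 t).const_add 1)
  have e4 := hd (fun t => 2 * t + t * (1 + t * (0 + t * 1))) (fun t => 2 + (1 + 3 * t ^ 2))
    (fun t => by
      have := ((hasDerivAt_id' t).const_mul 2).add ((hasDerivAt_id' t).add (hasDerivAt_pow 3 t))
      convert! this using 1
      · ext x; simp; ring
      · norm_num)
  rw [iteratedDeriv_succ, iteratedDeriv_succ, iteratedDeriv_succ, iteratedDeriv_succ,
    iteratedDeriv_zero, e0, e1, e2, e3, e4] at h
  norm_num at h
  exact h.symm

lemma integral_sq_gaussianReal : ∫ x, x ^ 2 ∂(gaussianReal 0 1) = 1 := by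
  have h := variance_fun_id_gaussianReal (μ := 0) (v := 1)
  rw [variance_eq_integral (by fun_prop), integral_id_gaussianReal] at h
  simpa using h

/-! ### Moments of independent sums and independence of columns -/

section

variable {Ω : Type*} {mΩ : MeasurableSpace Ω} {P : Measure Ω}

lemma MeasureTheory.MemLp.integrable_pow_of_le [IsProbabilityMeasure P] {X : Ω → ℝ} {p : ℕ}
    (hX : MemLp X p P) {k : ℕ}
    (hk : k ≤ p) : Integrable (fun ω => X ω ^ k) P := by
  have h : MemLp X k P := hX.mono_exponent (by exact_mod_cast hk)
  have := h.integrable_norm_pow'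
  refine this.mono' (h.aestronglyMeasurable.pow k) (ae_of_all _ fun ω => ?_)
  simp

lemma ProbabilityTheory.IndepFun.integral_pow_mul_pow {X Y : Ω → ℝ} (h : X ⟂ᵢ[P] Y)
    (hX : AEMeasurable X P) (hY : AEMeasurable Y P) (j k : ℕ) :
    ∫ ω, X ω ^ j * Y ω ^ k ∂P = (∫ ω, X ω ^ j ∂P) * ∫ ω, Y ω ^ k ∂P :=
  (h.comp (φ := (· ^ j)) (ψ := (· ^ k)) (by fun_prop) (by fun_prop)).integral_mul_eq_mul_integral
    (hX.pow_const j).aestronglyMeasurable (hY.pow_const k).aestronglyMeasurable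

lemma ProbabilityTheory.IndepFun.integrable_pow_mul_pow {X Y : Ω → ℝ} (h : X ⟂ᵢ[P] Y)
    {j k : ℕ} (hX : Integrable (fun ω => X ω ^ j) P) (hY : Integrable (fun ω => Y ω ^ k) P) :
    Integrable (fun ω => X ω ^ j * Y ω ^ k) P :=
  (h.comp (φ := (· ^ j)) (ψ := (· ^ k)) (by fun_prop) (by fun_prop)).integrable_mul hX hY

lemma ProbabilityTheory.IndepFun.integral_add_sq [IsProbabilityMeasure P] {X Y : Ω → ℝ} (h : X ⟂ᵢ[P] Y)
    (hX : MemLp X 4 P) (hY : MemLp Y 4 P) (hY1 : ∫ ω, Y ω ∂P = 0) :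
    ∫ ω, (X ω + Y ω) ^ 2 ∂P = ∫ ω, X ω ^ 2 ∂P + ∫ ω, Y ω ^ 2 ∂P := by
  have iX (k : ℕ) (hk : k ≤ 4) := hX.integrable_pow_of_le (p := 4) hk
  have iY (k : ℕ) (hk : k ≤ 4) := hY.integrable_pow_of_le (p := 4) hk
  have i11 := h.integrable_pow_mul_pow (iX 1 (by norm_num)) (iY 1 (by norm_num))
  have e (ω : Ω) : (X ω + Y ω) ^ 2 = X ω ^ 2 + 2 * (X ω ^ 1 * Y ω ^ 1) + Y ω ^ 2 := by ring
  have i12 : Integrable (fun ω => X ω ^ 2 + 2 * (X ω ^ 1 * Y ω ^ 1)) P :=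
    (iX 2 (by norm_num)).add (i11.const_mul 2)
  simp_rw [e]
  rw [integral_add i12 (iY 2 (by norm_num)),
    integral_add (iX 2 (by norm_num)) (i11.const_mul 2), integral_const_mul,
    h.integral_pow_mul_pow hX.aemeasurable hY.aemeasurable]
  simp [hY1]

/-- In the binomial expansion every term with an odd exponent contains a first moment, hence
vanishes. -/
lemma ProbabilityTheory.IndepFun.integral_add_pow_four [IsProbabilityMeasure P] {X Y : Ω → ℝ} (h : X ⟂ᵢ[P] Y)
    (hX : MemLp X 4 P) (hY : MemLp Y 4 P) (hX1 : ∫ ω, X ω ∂P = 0) (hY1 : ∫ ω, Y ω ∂P = 0) :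
    ∫ ω, (X ω + Y ω) ^ 4 ∂P = ∫ ω, X ω ^ 4 ∂P
      + 6 * ((∫ ω, X ω ^ 2 ∂P) * ∫ ω, Y ω ^ 2 ∂P) + ∫ ω, Y ω ^ 4 ∂P := by
  have iX (k : ℕ) (hk : k ≤ 4) := hX.integrable_pow_of_le (p := 4) hk
  have iY (k : ℕ) (hk : k ≤ 4) := hY.integrable_pow_of_le (p := 4) hk
  have i (j k : ℕ) (hj : j ≤ 4) (hk : k ≤ 4) := h.integrable_pow_mul_pow (iX j hj) (iY k hk)
  have e (ω : Ω) : (X ω + Y ω) ^ 4 = ∑ k ∈ Finset.range 5,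
      (X ω ^ k * Y ω ^ (4 - k)) * (Nat.choose 4 k : ℝ) := add_pow _ _ _
  simp_rw [e]
  rw [integral_finsetSum]
  · simp_rw [integral_mul_const, h.integral_pow_mul_pow hX.aemeasurable hY.aemeasurable]
    simp [Finset.sum_range_succ, Nat.choose, hX1, hY1]
    ring
  · intro k hk
    exact (i k (4 - k) (by simpa [Nat.lt_succ_iff] using hk) (by omega)).mul_const _

/-- The first, second and fourth moments of a sum of centered, reduced i.i.d. variables. -/
lemma moments_sum_range [IsProbabilityMeasure P] {X : ℕ → Ω → ℝ} (hindep : iIndepFun X P) (hX : ∀ i, MemLp (X i) 4 P)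
    (h1 : ∀ i, ∫ ω, X i ω ∂P = 0) (h2 : ∀ i, ∫ ω, X i ω ^ 2 ∂P = 1) {μ₄ : ℝ}
    (h4 : ∀ i, ∫ ω, X i ω ^ 4 ∂P = μ₄) (m : ℕ) :
    MemLp (fun ω => ∑ i ∈ Finset.range m, X i ω) 4 P ∧
    ∫ ω, ∑ i ∈ Finset.range m, X i ω ∂P = 0 ∧
    ∫ ω, (∑ i ∈ Finset.range m, X i ω) ^ 2 ∂P = m ∧
    ∫ ω, (∑ i ∈ Finset.range m, X i ω) ^ 4 ∂P = 3 * m * (m - 1) + m * μ₄ := by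
  have hL (m : ℕ) : MemLp (fun ω => ∑ i ∈ Finset.range m, X i ω) 4 P :=
    memLp_finsetSum _ fun i _ => hX i
  refine ⟨hL m, ?_, ?_⟩
  · rw [integral_finsetSum _ fun i _ => (hX i).integrable (by norm_num)]
    simp [h1]
  have hm1 (m : ℕ) : ∫ ω, ∑ i ∈ Finset.range m, X i ω ∂P = 0 := by
    rw [integral_finsetSum _ fun i _ => (hX i).integrable (by norm_num)]
    simp [h1]
  induction m with
  | zero => simp
  | succ m ih =>
    have hind : (fun ω => ∑ i ∈ Finset.range m, X i ω) ⟂ᵢ[P] X m := by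
      have := hindep.indepFun_sum_range_succ₀ (fun i => (hX i).aemeasurable) m
      convert this using 1
      ext ω; simp
    simp_rw [Finset.sum_range_succ]
    rw [hind.integral_add_sq (hL m) (hX m) (h1 m),
      hind.integral_add_pow_four (hL m) (hX m) (hm1 m) (h1 m), ih.1, ih.2, h2, h4]
    push_cast
    exact ⟨rfl, by ring⟩

/-- The columns of an independent array are independent as processes. -/
lemma ProbabilityTheory.iIndepFun.columns [IsProbabilityMeasure P] {ξ : ℕ → ℕ → Ω → ℝ}
    (hm : ∀ i j, AEMeasurable (ξ i j) P) (h : iIndepFun (fun p : ℕ × ℕ => ξ p.1 p.2) P) :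
    iIndepFun (fun j ω i => ξ i j ω) P := by
  have : ∀ i j, IsProbabilityMeasure (P.map (ξ i j)) :=
    fun i j => Measure.isProbabilityMeasure_map (hm i j)
  have hcol (j : ℕ) : iIndepFun (fun i => ξ i j) P :=
    h.precomp (g := fun i => (i, j)) fun a b hab => by simpa using hab
  have h' : iIndepFun (fun p : (_ : ℕ) × ℕ => ξ p.2 p.1) P :=
    h.precomp (g := fun p : (_ : ℕ) × ℕ => (p.2, p.1)) fun a b hab => by
      rcases a with ⟨a, a'⟩; rcases b with ⟨b, b'⟩
      simp at hab ⊢; tauto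
  have hmc (j : ℕ) : AEMeasurable (fun ω i => ξ i j ω) P := aemeasurable_pi_lambda _ (hm · j)
  rw [iIndepFun_iff_map_fun_eq_infinitePi_map₀' hmc]
  have e := h'.map_fun_eq_infinitePi_map₀' (fun p : (_ : ℕ) × ℕ => hm p.2 p.1)
  -- Currying turns the product law of the whole array into a product over columns of product laws,
  -- and each inner product is the law of one column.
  have e2 := congrArg (Measure.map (MeasurableEquiv.piCurry fun _ _ : ℕ => ℝ)) e
  rw [AEMeasurable.map_map_of_aemeasurable (by fun_prop)
    (aemeasurable_pi_lambda _ fun p : (_ : ℕ) × ℕ => hm p.2 p.1),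
    Measure.infinitePi_map_piCurry (fun j i => P.map (ξ i j))] at e2
  refine Eq.trans ?_ (e2.trans ?_)
  · rfl
  · congr 1 with j
    rw [(hcol j).map_fun_eq_infinitePi_map₀' fun i => hm i j]

end

/-! ### The summands `normalizedSquare` -/

/-- The centered and reduced square of the normalized partial sum `(x 0 + ⋯ + x (m - 1)) / √m`. -/
noncomputable def normalizedSquare (m : ℕ) (x : ℕ → ℝ) : ℝ :=
  ((∑ i ∈ Finset.range m, x i) ^ 2 / m - 1) / √2

lemma measurable_normalizedSquare (m : ℕ) : Measurable (normalizedSquare m) := by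
  unfold normalizedSquare
  fun_prop

lemma normalizedSquare_sq (m : ℕ) (x : ℕ → ℝ) :
    normalizedSquare m x ^ 2 = ((∑ i ∈ Finset.range m, x i) ^ 4 / m ^ 2
      - 2 * ((∑ i ∈ Finset.range m, x i) ^ 2 / m) + 1) / 2 := by
  rw [normalizedSquare, div_pow, Real.sq_sqrt zero_le_two]
  ring

lemma norm_sq_walkPosition {Ω : Type*} (ξ : ℕ → ℕ → Ω → ℝ) (d k : ℕ) (ω : Ω) :
    ‖walkPosition ξ d k ω‖ ^ 2 =
      (d : ℝ)⁻¹ * ∑ j ∈ Finset.range d, (∑ i ∈ Finset.range k, ξ i j ω) ^ 2 := by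
  have h (j : Fin d) : walkPosition ξ d k ω j = (√(d : ℝ))⁻¹ * ∑ i ∈ Finset.range k, ξ i j ω := by
    simp [walkPosition, walkIncrement, Finset.mul_sum]
  simp_rw [EuclideanSpace.real_norm_sq_eq, h, mul_pow, ← Finset.mul_sum, inv_pow,
    Real.sq_sqrt (Nat.cast_nonneg d)]
  rw [Finset.sum_range fun j => (∑ i ∈ Finset.range k, ξ i j ω) ^ 2]

/-- This identity turns the theorem into a CLT over columns; it rests on `√(2k²/d) = √2 · k / √d`.
-/
lemma norm_sq_walkPosition_sub_div {Ω : Type*} (ξ : ℕ → ℕ → Ω → ℝ) {d k : ℕ} (hd : 0 < d)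
    (hk : 0 < k) (ω : Ω) :
    (‖walkPosition ξ d k ω‖ ^ 2 - (k : ℝ)) / √(2 * (k : ℝ) ^ 2 / (d : ℝ)) =
      (√(d : ℝ))⁻¹ * ∑ j ∈ Finset.range d, normalizedSquare k (fun i => ξ i j ω) := by
  have hd' : (0 : ℝ) < d := by exact_mod_cast hd
  have hk' : (0 : ℝ) < k := by exact_mod_cast hk
  rw [norm_sq_walkPosition]
  simp_rw [normalizedSquare]
  rw [← Finset.sum_div, Finset.sum_sub_distrib, ← Finset.sum_div, Real.sqrt_div (by positivity),
    Real.sqrt_mul zero_le_two, Real.sqrt_sq hk'.le]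
  simp only [Finset.sum_const, Finset.card_range, nsmul_eq_mul, mul_one]
  have hs : √(d : ℝ) ^ 2 = d := Real.sq_sqrt hd'.le
  have : √(d : ℝ) ≠ 0 := by positivity
  field_simp
  rw [hs]
  ring

section

variable {Ω : Type*} {mΩ : MeasurableSpace Ω} {P : Measure Ω} [IsProbabilityMeasure P]
  {X : ℕ → Ω → ℝ} {μ₄ : ℝ}

lemma memLp_two_normalizedSquare (hX : ∀ i, MemLp (X i) 4 P) (m : ℕ) :
    MemLp (fun ω => normalizedSquare m (fun i => X i ω)) 2 P := by
  have hL : MemLp (fun ω => ∑ i ∈ Finset.range m, X i ω) 4 P := memLp_finsetSum _ fun i _ => hX i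
  have hm : AEStronglyMeasurable (fun ω => normalizedSquare m (fun i => X i ω)) P :=
    ((measurable_normalizedSquare m).comp_aemeasurable
      (aemeasurable_pi_lambda _ fun i => (hX i).aemeasurable)).aestronglyMeasurable
  rw [memLp_two_iff_integrable_sq hm]
  simp_rw [normalizedSquare_sq]
  exact ((((hL.integrable_pow_of_le (p := 4) le_rfl).div_const _).sub
    (((hL.integrable_pow_of_le (p := 4) (k := 2) (by norm_num)).div_const _).const_mul 2)).add
      (integrable_const 1)).div_const 2

lemma integral_normalizedSquare (hindep : iIndepFun X P) (hX : ∀ i, MemLp (X i) 4 P)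
    (h1 : ∀ i, ∫ ω, X i ω ∂P = 0) (h2 : ∀ i, ∫ ω, X i ω ^ 2 ∂P = 1)
    (h4 : ∀ i, ∫ ω, X i ω ^ 4 ∂P = μ₄) {m : ℕ} (hm : 0 < m) :
    ∫ ω, normalizedSquare m (fun i => X i ω) ∂P = 0 := by
  obtain ⟨hL, -, hs, -⟩ := moments_sum_range hindep hX h1 h2 h4 m
  have i2 := hL.integrable_pow_of_le (p := 4) (k := 2) (by norm_num)
  simp_rw [normalizedSquare]
  rw [integral_div, integral_sub (i2.div_const _) (integrable_const _), integral_div, hs,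
    div_self (by positivity)]
  simp

/-- Expanding the square gives `(E S⁴ / m² - 2 E S² / m + 1) / 2` with `E S² = m` and `E S⁴ = 3m(m -
1) + m μ₄`. -/
lemma integral_normalizedSquare_sq (hindep : iIndepFun X P) (hX : ∀ i, MemLp (X i) 4 P)
    (h1 : ∀ i, ∫ ω, X i ω ∂P = 0) (h2 : ∀ i, ∫ ω, X i ω ^ 2 ∂P = 1)
    (h4 : ∀ i, ∫ ω, X i ω ^ 4 ∂P = μ₄) {m : ℕ} (hm : 0 < m) :
    ∫ ω, normalizedSquare m (fun i => X i ω) ^ 2 ∂P = 1 + (μ₄ - 3) / 2 * (m : ℝ)⁻¹ := by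
  obtain ⟨hL, -, hs, hf⟩ := moments_sum_range hindep hX h1 h2 h4 m
  have i2 := ((hL.integrable_pow_of_le (p := 4) (k := 2) (by norm_num)).div_const
    (m : ℝ)).const_mul 2
  have i4 := (hL.integrable_pow_of_le (p := 4) le_rfl).div_const ((m : ℝ) ^ 2)
  have i42 : Integrable (fun ω => (∑ i ∈ Finset.range m, X i ω) ^ 4 / (m : ℝ) ^ 2
      - 2 * ((∑ i ∈ Finset.range m, X i ω) ^ 2 / m)) P := i4.sub i2
  simp_rw [normalizedSquare_sq]
  rw [integral_div, integral_add i42 (integrable_const _), integral_sub i4 i2, integral_const_mul,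
    integral_div, integral_div, hs, hf]
  have : (m : ℝ) ≠ 0 := by positivity
  simp
  field_simp
  ring

lemma tendsto_integral_normalizedSquare_sq (hindep : iIndepFun X P) (hX : ∀ i, MemLp (X i) 4 P)
    (h1 : ∀ i, ∫ ω, X i ω ∂P = 0) (h2 : ∀ i, ∫ ω, X i ω ^ 2 ∂P = 1)
    (h4 : ∀ i, ∫ ω, X i ω ^ 4 ∂P = μ₄) :
    Tendsto (fun m => ∫ ω, normalizedSquare m (fun i => X i ω) ^ 2 ∂P) atTop (𝓝 1) := by
  have : Tendsto (fun m : ℕ => 1 + (μ₄ - 3) / 2 * (m : ℝ)⁻¹) atTop (𝓝 1) := by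
    simpa using (tendsto_inv_atTop_nhds_zero_nat.const_mul ((μ₄ - 3) / 2)).const_add (1 : ℝ)
  refine this.congr' ?_
  filter_upwards [eventually_gt_atTop 0] with m hm
  exact (integral_normalizedSquare_sq hindep hX h1 h2 h4 hm).symm

/-- The squares of the variables `normalizedSquare m` are asymptotically uniformly integrable. -/
lemma exists_eventually_integral_normalizedSquare_sq_sub_min_le (hindep : iIndepFun X P)
    (hident : ∀ i, IdentDistrib (X i) (X 0) P P) (hX : ∀ i, MemLp (X i) 4 P)
    (h1 : ∀ i, ∫ ω, X i ω ∂P = 0) (h2 : ∀ i, ∫ ω, X i ω ^ 2 ∂P = 1)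
    (h4 : ∀ i, ∫ ω, X i ω ^ 4 ∂P = μ₄) {ε : ℝ} (hε : 0 < ε) :
    ∃ K : ℝ, 0 ≤ K ∧ ∀ᶠ m in atTop, ∫ ω, (normalizedSquare m (fun i => X i ω) ^ 2
      - min (normalizedSquare m (fun i => X i ω) ^ 2) K) ∂P ≤ ε := by
  have hclt := tendstoInDistribution_inv_sqrt_mul_sum (P' := gaussianReal 0 1) (Y := id)
    HasLaw.id (h1 0) (h2 0) hindep hident
  have hg : Continuous fun x : ℝ => (x ^ 4 - 2 * x ^ 2 + 1) / 2 := by fun_prop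
  have hW : TendstoInDistribution (fun m ω => normalizedSquare m (fun i => X i ω) ^ 2) atTop
      (fun x : ℝ => (x ^ 4 - 2 * x ^ 2 + 1) / 2) (fun _ => P) (gaussianReal 0 1) := by
    convert! hclt.continuous_comp hg using 1
    ext m ω
    have hs : ((√(m : ℝ))⁻¹) ^ 2 = (m : ℝ)⁻¹ := by
      rw [inv_pow, Real.sq_sqrt (Nat.cast_nonneg m)]
    have hs4 : ((√(m : ℝ))⁻¹) ^ 4 = ((m : ℝ) ^ 2)⁻¹ := by
      rw [show 4 = 2 * 2 from rfl, pow_mul, hs, inv_pow]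
    simp only [Function.comp_apply, normalizedSquare_sq, mul_pow, hs, hs4, div_eq_inv_mul]
  have hg4 : MemLp (id : ℝ → ℝ) 4 (gaussianReal 0 1) := memLp_id_gaussianReal' 4 (by norm_num)
  have j4 : Integrable (fun x : ℝ => x ^ 4) (gaussianReal 0 1) :=
    hg4.integrable_pow_of_le (p := 4) le_rfl
  have j2 : Integrable (fun x : ℝ => 2 * x ^ 2) (gaussianReal 0 1) :=
    (hg4.integrable_pow_of_le (p := 4) (k := 2) (by norm_num)).const_mul 2
  have j42 : Integrable (fun x : ℝ => x ^ 4 - 2 * x ^ 2) (gaussianReal 0 1) := j4.sub j2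
  -- `(3 - 2 + 1) / 2 = 1` agrees with the limit of the second moments, so no mass escapes to
  -- infinity.
  have hlim : ∫ x : ℝ, (x ^ 4 - 2 * x ^ 2 + 1) / 2 ∂(gaussianReal 0 1) = 1 := by
    rw [integral_div, integral_add j42 (integrable_const _), integral_sub j4 j2,
      integral_const_mul, integral_pow_four_gaussianReal, integral_sq_gaussianReal]
    norm_num
  refine exists_eventually_integral_sub_min_le hW (fun m ω => sq_nonneg _) (fun x => ?_)
    (fun m => (memLp_two_normalizedSquare hX m).integrable_sq)
    ((j42.add (integrable_const 1)).div_const 2) ?_ hε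
  · nlinarith [sq_nonneg (x ^ 2 - 1)]
  · rw [hlim]
    exact tendsto_integral_normalizedSquare_sq hindep hX h1 h2 h4

end

/-! ### The limit theorem -/

theorem mainTheorem7
    {Ω Ω' : Type*} [MeasurableSpace Ω] [MeasurableSpace Ω']
    (P : Measure Ω) [IsProbabilityMeasure P] (P' : Measure Ω') [IsProbabilityMeasure P']
    (ξ₀ : Ω' → ℝ)
    (hmean : ∫ ω, ξ₀ ω ∂P' = 0)
    (hvar : ∫ ω, ξ₀ ω ^ 2 ∂P' = 1)
    (hfourth : Integrable (fun ω => ξ₀ ω ^ 4) P')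
    (ξ : ℕ → ℕ → Ω → ℝ)
    (hindep : iIndepFun (fun p : ℕ × ℕ => ξ p.1 p.2) P)
    (hcopies : ∀ i j, IdentDistrib (ξ i j) ξ₀ P P')
    (n : ℕ → ℕ) (hn : Tendsto n atTop atTop) :
    TendstoInDistribution
      (fun (d : ℕ) (ω : Ω) =>
        (‖walkPosition ξ d (n d) ω‖ ^ 2 - (n d : ℝ)) / √(2 * (n d : ℝ) ^ 2 / (d : ℝ)))
      atTop (id : ℝ → ℝ) (fun _ => P) (gaussianReal 0 1) := by
  have hm (i j : ℕ) : AEMeasurable (ξ i j) P := (hcopies i j).aemeasurable_fst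
  have hξ₀ : MemLp ξ₀ 4 P' := by
    have hm₀ := (hcopies 0 0).aemeasurable_snd.aestronglyMeasurable
    rw [← integrable_norm_rpow_iff hm₀ (by norm_num) (by norm_num)]
    refine hfourth.congr (ae_of_all _ fun ω => ?_)
    simp only [ENNReal.toReal_ofNat, Real.norm_eq_abs]
    rw [show (4 : ℝ) = (4 : ℕ) by norm_num, Real.rpow_natCast, Even.pow_abs (by decide)]
  have hcol (j : ℕ) : iIndepFun (fun i => ξ i j) P :=
    hindep.precomp (g := fun i => (i, j)) fun a b hab => by simpa using hab
  have hX (i : ℕ) : MemLp (ξ i 0) 4 P := (hcopies i 0).memLp_iff.2 hξ₀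
  have h1 (i : ℕ) : ∫ ω, ξ i 0 ω ∂P = 0 := (hcopies i 0).integral_eq.trans hmean
  have hpow (k i : ℕ) : ∫ ω, ξ i 0 ω ^ k ∂P = ∫ ω, ξ₀ ω ^ k ∂P' :=
    ((hcopies i 0).comp (u := (· ^ k)) (by fun_prop)).integral_eq
  have h2 (i : ℕ) : ∫ ω, ξ i 0 ω ^ 2 ∂P = 1 := (hpow 2 i).trans hvar
  have hident (i j i' j' : ℕ) : IdentDistrib (ξ i j) (ξ i' j') P P :=
    (hcopies i j).trans (hcopies i' j').symm
  -- Column 0 represents all columns, since they share one law. The mean vanishes only for `n d >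
  -- 0`, hence the eventual statement.
  have hlim (t : ℝ) := tendsto_charFun_pow_of_uniform_truncation
    (W := fun d ω => normalizedSquare (n d) (fun i => ξ i 0 ω))
    (fun d => memLp_two_normalizedSquare hX (n d))
    ((hn.eventually_gt_atTop 0).mono fun d hd =>
      integral_normalizedSquare (hcol 0) hX h1 h2 (hpow 4) hd)
    ((tendsto_integral_normalizedSquare_sq (hcol 0) hX h1 h2 (hpow 4)).comp hn)
    (fun ε hε => by
      obtain ⟨K, hK0, hK⟩ := exists_eventually_integral_normalizedSquare_sq_sub_min_le (hcol 0)
        (fun i => hident i 0 0 0) hX h1 h2 (hpow 4) hε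
      exact ⟨K, hK0, hn.eventually hK⟩) t
  have hWindep (m : ℕ) : iIndepFun (fun j ω => normalizedSquare m (fun i => ξ i j ω)) P :=
    (hindep.columns hm).comp₀ (fun _ => normalizedSquare m)
      (fun j => aemeasurable_pi_lambda _ fun i => hm i j)
      (fun _ => (measurable_normalizedSquare m).aemeasurable)
  have hWident (m j : ℕ) : IdentDistrib (fun ω => normalizedSquare m (fun i => ξ i j ω))
      (fun ω => normalizedSquare m (fun i => ξ i 0 ω)) P P :=
    (IdentDistrib.pi (fun i => hident i j i 0) (hcol j) (hcol 0)).comp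
      (measurable_normalizedSquare m)
  have hmeas (d : ℕ) : AEMeasurable (fun ω =>
      (‖walkPosition ξ d (n d) ω‖ ^ 2 - (n d : ℝ)) / √(2 * (n d : ℝ) ^ 2 / (d : ℝ))) P := by
    simp_rw [norm_sq_walkPosition]
    fun_prop
  refine ⟨hmeas, aemeasurable_id, ?_⟩
  refine ProbabilityMeasure.tendsto_iff_tendsto_charFun.2 fun t => ?_
  have hgauss : charFun ((gaussianReal 0 1).map (id : ℝ → ℝ)) t
      = Complex.exp (-(t : ℂ) ^ 2 / 2) := by
    rw [Measure.map_id, charFun_gaussianReal]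
    simp [neg_div]
  simp only [ProbabilityMeasure.coe_mk, hgauss]
  refine (hlim t).congr' ?_
  filter_upwards [eventually_gt_atTop 0, hn.eventually_gt_atTop 0] with d hd hnd
  simp_rw [norm_sq_walkPosition_sub_div ξ hd hnd]
  -- For fixed `d` the summands are i.i.d. over columns, so the characteristic function of their
  -- scaled sum is a `d`-th power.
  exact (charFun_inv_sqrt_mul_sum (hWindep (n d)) (hWident (n d))).symm
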